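/- Let $N\ge 2$, let $\Omega\subset\mathbb R^N$ be a bounded domain (open and connected) with $0\in\Omega$ (no regularity of $\partial\Omega$ is assumed), let $\alpha\in(0,2)$ and $w(x)=|x|^\alpha$. Let $L^2(\Omega;w)$ be the space of (classes of) measurable $u:\Omega\to\mathbb R$ with $\int_\Omega u^2 w\,dx<\infty$, and let $$H^1_w(\Omega)=\Big\{u\in L^2(\Omega):\ \tfrac{\partial u}{\partial x_i}\in L^2(\Omega;w),\ i=1,\dots,N\Big\},\qquad \|u\|_{H^1_w(\Omega)}=\Big(\int_\Omega u^2 w\,dx+\sum_{i=1}^N\int_\Omega\Big|\frac{\partial u}{\partial x_i}\Big|^2 w\,dx\Big)^{1/2},$$ where the partial derivatives are distributional derivatives on $\Omega$ given by locally integrable functions. Let $H^1_{w,0}(\Omega)$ be the closure of $C_c^\infty(\Omega)$ in $H^1_w(\Omega)$ with respect to this norm. Then the embedding $H^1_{w,0}(\Omega)\hookrightarrow L^2(\Omega)$, $u\mapsto u$, is compact: it is an injective continuous linear map from $(H^1_{w,0}(\Omega),\|\cdot\|_{H^1_w(\Omega)})$ to $L^2(\Omega)$ that maps bounded sets to relatively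 compact sets. -/

import Mathlib

open MeasureTheory TopologicalSpace
open scoped Distributions ENNReal

noncomputable section

namespace WeightedSobolev

variable {N : ℕ}

/-- The power weight `w(x) = |x|^α` on `ℝ^N`. -/
def weight (α : ℝ) (x : EuclideanSpace ℝ (Fin N)) : ℝ := ‖x‖ ^ α

/-- The measure `w dx` on `Ω`, with `w = |x|^α`; so `L²(Ω; w)` is `Lp _ 2 (weightMeasure Ω α)`. -/
def weightMeasure (Ω : Opens (EuclideanSpace ℝ (Fin N))) (α : ℝ) :
    Measure (EuclideanSpace ℝ (Fin N)) :=
  (volume.restrict Ω).withDensity fun x => ENNReal.ofReal (weight α x)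

/-- `g = (g₁, …, g_N)` is the distributional gradient of `u` on `Ω`: both are locally integrable
on `Ω` and `∫_Ω u ∂ᵢφ dx = - ∫_Ω gᵢ φ dx` for every `i` and every test function `φ ∈ 𝓓(Ω)`. -/
def IsWeakGradient (Ω : Opens (EuclideanSpace ℝ (Fin N))) (u : EuclideanSpace ℝ (Fin N) → ℝ)
    (g : EuclideanSpace ℝ (Fin N) → EuclideanSpace ℝ (Fin N)) : Prop :=
  LocallyIntegrableOn u Ω ∧ LocallyIntegrableOn g Ω ∧
    ∀ (i : Fin N) (φ : 𝓓(Ω, ℝ)),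
      ∫ x in Ω, u x * fderiv ℝ φ x (EuclideanSpace.single i 1) = - ∫ x in Ω, g x i * φ x

theorem volume_absolutelyContinuous [NeZero N] (Ω : Opens (EuclideanSpace ℝ (Fin N))) (α : ℝ) :
    volume.restrict (Ω : Set (EuclideanSpace ℝ (Fin N))) ≪ weightMeasure Ω α := by
  refine withDensity_absolutelyContinuous' ?_ ?_
  · unfold weight
    fun_prop
  · have h : ∀ᵐ x ∂(volume.restrict (Ω : Set (EuclideanSpace ℝ (Fin N)))), x ≠ 0 :=
      ae_restrict_of_ae (Measure.ae_ne volume 0)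
    filter_upwards [h] with x hx
    have : 0 < weight α x := Real.rpow_pos_of_pos (norm_pos_iff.2 hx) α
    simpa using this

theorem integrable_mul_of_locallyIntegrableOn {Ω : Opens (EuclideanSpace ℝ (Fin N))}
    {u ψ : EuclideanSpace ℝ (Fin N) → ℝ} (hu : LocallyIntegrableOn u Ω) (hψ : Continuous ψ)
    (hc : HasCompactSupport ψ) (hs : tsupport ψ ⊆ Ω) :
    Integrable (fun x => u x * ψ x) (volume.restrict Ω) := by
  have h1 : IntegrableOn u (tsupport ψ) := hu.integrableOn_compact_subset hs hc
  have h2 : IntegrableOn (fun x => u x * ψ x) (tsupport ψ) :=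
    h1.mul_continuousOn hψ.continuousOn hc
  have h3 : Integrable (fun x => u x * ψ x) := by
    refine (integrableOn_iff_integrable_of_support_subset ?_).1 h2
    intro x hx
    refine subset_tsupport ψ ?_
    intro h0
    exact hx (by simp [h0])
  exact h3.restrict

theorem integrable_mul_fderiv {Ω : Opens (EuclideanSpace ℝ (Fin N))}
    {u : EuclideanSpace ℝ (Fin N) → ℝ} (hu : LocallyIntegrableOn u Ω) (φ : 𝓓(Ω, ℝ))
    (v : EuclideanSpace ℝ (Fin N)) :
    Integrable (fun x => u x * fderiv ℝ φ x v) (volume.restrict Ω) := by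
  refine integrable_mul_of_locallyIntegrableOn hu ?_ ?_ ?_
  · exact (φ.contDiff.continuous_fderiv (by simp)).clm_apply continuous_const
  · exact φ.hasCompactSupport.fderiv_apply ℝ v
  · exact (tsupport_fderiv_apply_subset ℝ v).trans φ.tsupport_subset

theorem locallyIntegrableOn_coord {Ω : Opens (EuclideanSpace ℝ (Fin N))}
    {g : EuclideanSpace ℝ (Fin N) → EuclideanSpace ℝ (Fin N)} (hg : LocallyIntegrableOn g Ω)
    (i : Fin N) : LocallyIntegrableOn (fun x => g x i) Ω := by
  intro x hx
  obtain ⟨s, hs, hi⟩ := hg x hx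
  exact ⟨s, hs, (EuclideanSpace.proj (𝕜 := ℝ) i).integrable_comp hi⟩

theorem integrable_coord_mul {Ω : Opens (EuclideanSpace ℝ (Fin N))}
    {g : EuclideanSpace ℝ (Fin N) → EuclideanSpace ℝ (Fin N)} (hg : LocallyIntegrableOn g Ω)
    (φ : 𝓓(Ω, ℝ)) (i : Fin N) :
    Integrable (fun x => g x i * φ x) (volume.restrict Ω) :=
  integrable_mul_of_locallyIntegrableOn (locallyIntegrableOn_coord hg i) φ.continuous
    φ.hasCompactSupport φ.tsupport_subset

theorem IsWeakGradient.add {Ω : Opens (EuclideanSpace ℝ (Fin N))}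
    {u v : EuclideanSpace ℝ (Fin N) → ℝ}
    {g h : EuclideanSpace ℝ (Fin N) → EuclideanSpace ℝ (Fin N)}
    (hu : IsWeakGradient Ω u g) (hv : IsWeakGradient Ω v h) :
    IsWeakGradient Ω (u + v) (g + h) := by
  refine ⟨hu.1.add hv.1, hu.2.1.add hv.2.1, fun i φ => ?_⟩
  simp only [Pi.add_apply, PiLp.add_apply, add_mul]
  rw [integral_add (integrable_mul_fderiv hu.1 φ _) (integrable_mul_fderiv hv.1 φ _),
    integral_add (integrable_coord_mul hu.2.1 φ i) (integrable_coord_mul hv.2.1 φ i),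
    hu.2.2, hv.2.2, neg_add]

theorem IsWeakGradient.const_smul {Ω : Opens (EuclideanSpace ℝ (Fin N))}
    {u : EuclideanSpace ℝ (Fin N) → ℝ}
    {g : EuclideanSpace ℝ (Fin N) → EuclideanSpace ℝ (Fin N)}
    (hu : IsWeakGradient Ω u g) (c : ℝ) : IsWeakGradient Ω (c • u) (c • g) := by
  refine ⟨hu.1.smul c, hu.2.1.smul c, fun i φ => ?_⟩
  simp only [Pi.smul_apply, PiLp.smul_apply, smul_eq_mul, mul_assoc]
  rw [integral_const_mul, integral_const_mul, hu.2.2, mul_neg]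

theorem IsWeakGradient.zero (Ω : Opens (EuclideanSpace ℝ (Fin N))) :
    IsWeakGradient Ω 0 0 := by
  refine ⟨locallyIntegrableOn_zero, locallyIntegrableOn_zero, fun i φ => ?_⟩
  simp

theorem IsWeakGradient.congr {Ω : Opens (EuclideanSpace ℝ (Fin N))}
    {u v : EuclideanSpace ℝ (Fin N) → ℝ}
    {g h : EuclideanSpace ℝ (Fin N) → EuclideanSpace ℝ (Fin N)}
    (hu : IsWeakGradient Ω u g)
    (huv : u =ᵐ[volume.restrict (Ω : Set (EuclideanSpace ℝ (Fin N)))] v)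
    (hgh : g =ᵐ[volume.restrict (Ω : Set (EuclideanSpace ℝ (Fin N)))] h) :
    IsWeakGradient Ω v h := by
  have key : ∀ {F : Type} [NormedAddCommGroup F] {a b : EuclideanSpace ℝ (Fin N) → F},
      a =ᵐ[volume.restrict (Ω : Set (EuclideanSpace ℝ (Fin N)))] b →
      LocallyIntegrableOn a Ω → LocallyIntegrableOn b Ω := by
    intro F _ a b hab ha
    rw [locallyIntegrableOn_iff Ω.isOpen.isLocallyClosed] at ha ⊢
    intro k hk hc
    exact (ha k hk hc).congr (ae_restrict_of_ae_restrict_of_subset hk hab)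
  refine ⟨key huv hu.1, key hgh hu.2.1, fun i φ => ?_⟩
  have e1 : ∫ x in Ω, v x * fderiv ℝ φ x (EuclideanSpace.single i 1) =
      ∫ x in Ω, u x * fderiv ℝ φ x (EuclideanSpace.single i 1) := by
    refine integral_congr_ae ?_
    filter_upwards [huv] with x hx
    rw [hx]
  have e2 : ∫ x in Ω, h x i * φ x = ∫ x in Ω, g x i * φ x := by
    refine integral_congr_ae ?_
    filter_upwards [hgh] with x hx
    rw [hx]
  rw [e1, e2, hu.2.2]

/-- The weighted Sobolev space `H¹_w(Ω) = {u ∈ L²(Ω) : ∂u/∂xᵢ ∈ L²(Ω; w), i = 1, …, N}` for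
`w = |x|^α`. An element `u` is represented by the pair `(u, ∇u)` of classes in `L²(Ω; w)`, where
`∇u` is the distributional gradient of `u`. The norm inherited from the `ℓ²`-product is
`‖u‖² = ∫_Ω u² w dx + ∫_Ω |∇u|² w dx`.
(For `α > 0` and `Ω` bounded, a function in `L²(Ω)` is automatically in `L²(Ω; w)`.) -/
def H1 [NeZero N] (Ω : Opens (EuclideanSpace ℝ (Fin N))) (α : ℝ) :
    Submodule ℝ (WithLp 2 (Lp ℝ 2 (weightMeasure Ω α) ×
      Lp (EuclideanSpace ℝ (Fin N)) 2 (weightMeasure Ω α))) where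
  carrier := {p | MemLp p.fst 2 (volume.restrict (Ω : Set (EuclideanSpace ℝ (Fin N)))) ∧
    IsWeakGradient Ω p.fst p.snd}
  add_mem' := by
    intro p q hp hq
    have h1 := (volume_absolutelyContinuous Ω α).ae_eq (Lp.coeFn_add p.fst q.fst)
    have h2 := (volume_absolutelyContinuous Ω α).ae_eq (Lp.coeFn_add p.snd q.snd)
    exact ⟨(hp.1.add hq.1).ae_eq h1.symm, (hp.2.add hq.2).congr h1.symm h2.symm⟩
  zero_mem' := by
    have h1 := (volume_absolutelyContinuous Ω α).ae_eq (Lp.coeFn_zero ℝ 2 (weightMeasure Ω α))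
    have h2 := (volume_absolutelyContinuous Ω α).ae_eq
      (Lp.coeFn_zero (EuclideanSpace ℝ (Fin N)) 2 (weightMeasure Ω α))
    exact ⟨MemLp.zero.ae_eq h1.symm, (IsWeakGradient.zero Ω).congr h1.symm h2.symm⟩
  smul_mem' := by
    intro c p hp
    have h1 := (volume_absolutelyContinuous Ω α).ae_eq (Lp.coeFn_smul c p.fst)
    have h2 := (volume_absolutelyContinuous Ω α).ae_eq (Lp.coeFn_smul c p.snd)
    exact ⟨(hp.1.const_smul c).ae_eq h1.symm, (hp.2.const_smul c).congr h1.symm h2.symm⟩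

/-- The test functions `𝓓(Ω) = C_c^∞(Ω)`, as a subspace of `H¹_w(Ω)`. -/
def testSubmodule [NeZero N] (Ω : Opens (EuclideanSpace ℝ (Fin N))) (α : ℝ) :
    Submodule ℝ (H1 Ω α) where
  carrier := {p | ∃ φ : 𝓓(Ω, ℝ), p.1.fst =ᵐ[weightMeasure Ω α] φ}
  add_mem' := by
    rintro p q ⟨φ, hφ⟩ ⟨ψ, hψ⟩
    exact ⟨φ + ψ, (Lp.coeFn_add p.1.fst q.1.fst).trans (hφ.add hψ)⟩
  zero_mem' := ⟨0, Lp.coeFn_zero ℝ 2 (weightMeasure Ω α)⟩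
  smul_mem' := by
    rintro c p ⟨φ, hφ⟩
    exact ⟨c • φ, (Lp.coeFn_smul c p.1.fst).trans (hφ.const_smul c)⟩

/-- `H¹_{w,0}(Ω)`: the closure of `𝓓(Ω)` in the norm of `H¹_w(Ω)`. -/
def H10 [NeZero N] (Ω : Opens (EuclideanSpace ℝ (Fin N))) (α : ℝ) : Submodule ℝ (H1 Ω α) :=
  (testSubmodule Ω α).topologicalClosure

/-- The map `H¹_w(Ω) → L²(Ω)`, `u ↦ u`, into the unweighted space. -/
def toL2 [NeZero N] (Ω : Opens (EuclideanSpace ℝ (Fin N))) (α : ℝ) :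
    H1 Ω α →ₗ[ℝ] Lp ℝ 2 (volume.restrict (Ω : Set (EuclideanSpace ℝ (Fin N)))) where
  toFun p := p.2.1.toLp
  map_add' p q := by
    rw [← MemLp.toLp_add]
    exact MemLp.toLp_congr _ _
      ((volume_absolutelyContinuous Ω α).ae_eq (Lp.coeFn_add p.1.fst q.1.fst))
  map_smul' c p := by
    rw [RingHom.id_apply, ← MemLp.toLp_const_smul]
    exact MemLp.toLp_congr _ _
      ((volume_absolutelyContinuous Ω α).ae_eq (Lp.coeFn_smul c p.1.fst))

/-- The embedding `H¹_{w,0}(Ω) → L²(Ω)`, `u ↦ u`. -/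
def embedding [NeZero N] (Ω : Opens (EuclideanSpace ℝ (Fin N))) (α : ℝ) :
    H10 Ω α →ₗ[ℝ] Lp ℝ 2 (volume.restrict (Ω : Set (EuclideanSpace ℝ (Fin N)))) :=
  (toL2 Ω α).domRestrict (H10 Ω α)

end WeightedSobolev

end

/-! The embedding is an operator-norm limit of finite-rank maps. For a test function `φ`, the two
dangers are concentration at the origin, where the weight degenerates, and oscillation elsewhere.

Concentration is excluded by a Hardy inequality. For `β = (α - 2) / 2` the field `(‖x‖² + ρ²)^β x`
has divergence at least `α (‖x‖² + ρ²)^β` when `N ≥ 2`. Integrating by parts against `φ²` and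
absorbing half of the result gives `∫ φ² (‖x‖² + ρ²)^β ≤ (4 / α²) ∫ |∇φ|² |x|^α`. On the ball of
radius `ρ` the factor on the left is at least `(2ρ²)^β`, so `∫ φ²` over that ball is at most a
multiple of `ρ^(2 - α)` times the energy (`setIntegral_closedBall_sq_le`). A ball containing `Ω`
yields boundedness into `L²(Ω)`; a small ball yields a small error.

Away from the origin the weight is bounded below, and the Poincaré inequality on cubes of small side
`h` approximates `φ` by a constant on each cube, with squared error of order `h²` times the energy
(`exists_poincare_cube`). Together these give uniform approximation by step functions on finitely
many cubes (`exists_finiteDimensional_approximation`). Test functions extend by zero, so the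
boundary of `Ω` plays no role.

Estimates pass to the closure by Fatou's lemma and density. Injectivity holds because a function
determines its weak gradient. -/

noncomputable section

namespace WeightedSobolev

/-! ### Poincaré inequality on convex sets. -/

section ConvexPoincare

variable {E : Type*} [NormedAddCommGroup E] [NormedSpace ℝ E]

/-- Cauchy–Schwarz against the constant `1`, which has norm one for a probability measure. -/
theorem sq_lintegral_le_lintegral_sq {X : Type*} [MeasurableSpace X] {μ : Measure X}
    [IsProbabilityMeasure μ] {f : X → ℝ≥0∞} (hf : AEMeasurable f μ) :
    (∫⁻ t, f t ∂μ) ^ 2 ≤ ∫⁻ t, f t ^ 2 ∂μ := by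
  have h := ENNReal.lintegral_mul_le_Lp_mul_Lq μ (p := 2) (q := 2)
    (by constructor <;> norm_num) hf (aemeasurable_const (b := (1 : ℝ≥0∞)))
  simp only [Pi.mul_apply, mul_one, ENNReal.one_rpow, lintegral_const, measure_univ] at h
  calc (∫⁻ t, f t ∂μ) ^ 2 ≤ ((∫⁻ t, f t ^ (2 : ℝ) ∂μ) ^ (1 / 2 : ℝ)) ^ 2 := by gcongr
    _ = ∫⁻ t, f t ^ 2 ∂μ := by
      rw [← ENNReal.rpow_natCast, ← ENNReal.rpow_mul]
      norm_num

/-- The increment of a `C¹` function is controlled by its derivative along the segment. -/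
theorem enorm_sub_sq_le_lintegral_segment {φ : E → ℝ} (hφ : ContDiff ℝ 1 φ) (x z : E) :
    ‖φ (x + z) - φ x‖ₑ ^ 2 ≤
      ‖z‖ₑ ^ 2 * ∫⁻ t in Set.Ioc (0 : ℝ) 1, ‖fderiv ℝ φ (x + t • z)‖ₑ ^ 2 := by
  have hpath : Continuous fun t : ℝ => fderiv ℝ φ (x + t • z) :=
    (hφ.continuous_fderiv one_ne_zero).comp (by fun_prop)
  have hcont : Continuous fun t : ℝ => fderiv ℝ φ (x + t • z) z := hpath.clm_apply continuous_const
  have hprob : IsProbabilityMeasure (volume.restrict (Set.Ioc (0 : ℝ) 1)) := ⟨by simp⟩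
  have hftc : ∫ t in (0 : ℝ)..1, fderiv ℝ φ (x + t • z) z = φ (x + z) - φ x := by
    have := intervalIntegral.integral_eq_sub_of_hasDerivAt (a := 0) (b := 1)
      (f := fun t : ℝ => φ (x + t • z)) (f' := fun t => fderiv ℝ φ (x + t • z) z)
      (fun t _ => ?_) (hcont.intervalIntegrable _ _)
    · simpa using this
    · have h1 : HasDerivAt (fun t : ℝ => x + t • z) z t := by
        simpa using ((hasDerivAt_id t).smul_const z).const_add x
      exact ((hφ.differentiable one_ne_zero _).hasFDerivAt).comp_hasDerivAt t h1
  rw [← hftc, intervalIntegral.integral_of_le zero_le_one]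
  calc ‖∫ t in Set.Ioc (0 : ℝ) 1, fderiv ℝ φ (x + t • z) z‖ₑ ^ 2
      ≤ (∫⁻ t in Set.Ioc (0 : ℝ) 1, ‖fderiv ℝ φ (x + t • z) z‖ₑ) ^ 2 := by
        gcongr; exact enorm_integral_le_lintegral_enorm _
    _ ≤ ∫⁻ t in Set.Ioc (0 : ℝ) 1, ‖fderiv ℝ φ (x + t • z) z‖ₑ ^ 2 :=
        sq_lintegral_le_lintegral_sq hcont.enorm.measurable.aemeasurable
    _ ≤ ∫⁻ t in Set.Ioc (0 : ℝ) 1, ‖z‖ₑ ^ 2 * ‖fderiv ℝ φ (x + t • z)‖ₑ ^ 2 := by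
        refine lintegral_mono fun t => ?_
        rw [← mul_pow, mul_comm]
        gcongr
        exact ContinuousLinearMap.le_opENorm _ _
    _ = _ := lintegral_const_mul _ (hpath.enorm.measurable.pow_const 2)

variable [FiniteDimensional ℝ E] [MeasurableSpace E] [BorelSpace E]
  (μ : Measure E) [μ.IsAddHaarMeasure]

/-- Poincaré inequality for double integrals on a convex set of diameter at most `r`. -/
theorem lintegral_lintegral_enorm_sub_sq_le {φ : E → ℝ} (hφ : ContDiff ℝ 1 φ) {Q : Set E}
    (hQ : Convex ℝ Q) (hQm : MeasurableSet Q) {r : ℝ} (hr : ∀ x ∈ Q, ∀ y ∈ Q, ‖y - x‖ ≤ r) :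
    ∫⁻ x in Q, ∫⁻ y in Q, ‖φ y - φ x‖ₑ ^ 2 ∂μ ∂μ ≤
      μ (Metric.closedBall 0 r) * (ENNReal.ofReal r ^ 2 * ∫⁻ x in Q, ‖fderiv ℝ φ x‖ₑ ^ 2 ∂μ) := by
  -- Cutting the gradient off outside `Q` lets the integrals run over the whole space, where
  -- translation invariance is available.
  set H : E → ℝ≥0∞ := Q.indicator fun x => ‖fderiv ℝ φ x‖ₑ ^ 2 with hH
  have hHm : Measurable H := by
    have := (hφ.continuous_fderiv one_ne_zero).enorm
    exact Measurable.indicator (by fun_prop) hQm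
  have hcont := hφ.continuous
  -- Here `z` stands for `y - x`, which stays in the ball of radius `r`; convexity keeps the segment
  -- from `x` to `x + z` inside `Q`.
  set G : E → E → ℝ≥0∞ := fun x z => (Metric.closedBall (0 : E) r).indicator
    (fun z => ENNReal.ofReal r ^ 2 * ∫⁻ t in Set.Ioc (0 : ℝ) 1, H (x + t • z)) z with hG
  have hHm3 : Measurable fun p : (E × E) × ℝ => H (p.1.1 + p.2 • p.1.2) :=
    hHm.comp (by fun_prop)
  have hGm : Measurable (Function.uncurry G) := by
    have h1 : Measurable fun p : E × E =>
        ENNReal.ofReal r ^ 2 * ∫⁻ t in Set.Ioc (0 : ℝ) 1, H (p.1 + t • p.2) :=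
      hHm3.lintegral_prod_right'.const_mul _
    exact h1.indicator (measurable_snd Metric.isClosed_closedBall.measurableSet)
  have hpt : ∀ x ∈ Q, ∀ z, Q.indicator (fun y => ‖φ y - φ x‖ₑ ^ 2) (z + x) ≤ G x z := by
    intro x hx z
    by_cases hz : z + x ∈ Q
    · have hzr : ‖z‖ ≤ r := by simpa using hr x hx _ hz
      rw [Set.indicator_of_mem hz, hG]
      simp only
      rw [Set.indicator_of_mem (by simpa using hzr), add_comm z x]
      refine (enorm_sub_sq_le_lintegral_segment hφ x z).trans ?_
      gcongr ?_ ^ 2 * ?_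
      · rw [← ofReal_norm]; exact ENNReal.ofReal_le_ofReal hzr
      · refine setLIntegral_mono (hHm.comp (by fun_prop)) fun t ht => ?_
        rw [hH, Set.indicator_of_mem]
        exact hQ.add_smul_mem hx (by rwa [add_comm]) ⟨ht.1.le, ht.2⟩
    · rw [Set.indicator_of_notMem hz]; exact zero_le
  calc ∫⁻ x in Q, ∫⁻ y in Q, ‖φ y - φ x‖ₑ ^ 2 ∂μ ∂μ
      ≤ ∫⁻ x in Q, ∫⁻ z, G x z ∂μ ∂μ := by
        refine setLIntegral_mono' hQm fun x hx => ?_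
        rw [← lintegral_indicator hQm, ← lintegral_add_right_eq_self _ x]
        exact lintegral_mono (hpt x hx)
    _ ≤ ∫⁻ x, ∫⁻ z, G x z ∂μ ∂μ := setLIntegral_le_lintegral _ _
    _ = ∫⁻ z, ∫⁻ x, G x z ∂μ ∂μ := lintegral_lintegral_swap hGm.aemeasurable
    _ = ∫⁻ z in Metric.closedBall 0 r, ENNReal.ofReal r ^ 2 * ∫⁻ x, H x ∂μ ∂μ := by
        rw [← lintegral_indicator Metric.isClosed_closedBall.measurableSet]
        refine lintegral_congr fun z => ?_
        by_cases hz : z ∈ Metric.closedBall (0 : E) r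
        · simp only [hG, Set.indicator_of_mem hz]
          rw [lintegral_const_mul]
          · congr 1
            -- With `x` integrated first, the translation by `t • z` disappears, so the bound is
            -- uniform in `z` and `t`.
            rw [lintegral_lintegral_swap]
            · have : ∀ t : ℝ, ∫⁻ x, H (x + t • z) ∂μ = ∫⁻ x, H x ∂μ :=
                fun t => lintegral_add_right_eq_self _ _
              simp [this]
            · exact (hHm.comp (by fun_prop : Measurable fun p : E × ℝ => p.1 + p.2 • z)).aemeasurable
          · exact (hHm.comp
              (by fun_prop : Measurable fun p : E × ℝ => p.1 + p.2 • z)).lintegral_prod_right'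
        · simp [hG, hz]
    _ = _ := by
        rw [setLIntegral_const, hH, lintegral_indicator hQm, mul_comm]

/-- Poincaré inequality on a convex set, with a value of the function in place of its mean. -/
theorem exists_lintegral_enorm_sub_sq_le {φ : E → ℝ} (hφ : ContDiff ℝ 1 φ) {Q : Set E}
    (hQ : Convex ℝ Q) (hQm : MeasurableSet Q) {r : ℝ} (hr : ∀ x ∈ Q, ∀ y ∈ Q, ‖y - x‖ ≤ r)
    (h0 : μ Q ≠ 0) (htop : μ Q ≠ ∞) :
    ∃ a : ℝ, ∫⁻ x in Q, ‖φ x - a‖ₑ ^ 2 ∂μ ≤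
      μ (Metric.closedBall 0 r) / μ Q *
        (ENNReal.ofReal r ^ 2 * ∫⁻ x in Q, ‖fderiv ℝ φ x‖ₑ ^ 2 ∂μ) := by
  have hcont := hφ.continuous
  have hm : Measurable fun p : E × E => ‖φ p.2 - φ p.1‖ₑ ^ 2 := by
    have : Continuous fun p : E × E => ‖φ p.2 - φ p.1‖ₑ := by fun_prop
    fun_prop
  -- Some point of `Q` does no worse than the average of the double integral; the value of `φ` there
  -- serves as the constant.
  obtain ⟨x, -, hx⟩ := exists_le_setLAverage (μ := μ) (s := Q)
    (f := fun x => ∫⁻ y in Q, ‖φ y - φ x‖ₑ ^ 2 ∂μ) h0 htop hm.lintegral_prod_right'.aemeasurable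
  refine ⟨φ x, hx.trans ?_⟩
  rw [setLAverage_eq, div_eq_mul_inv, div_eq_mul_inv, mul_right_comm]
  gcongr
  exact lintegral_lintegral_enorm_sub_sq_le μ hφ hQ hQm hr

end ConvexPoincare

/-! ### Compactness from finite-dimensional approximation. -/

section FunctionalAnalysis

variable {F G : Type*} [SeminormedAddCommGroup F] [NormedSpace ℝ F]
  [NormedAddCommGroup G] [InnerProductSpace ℝ G] [CompleteSpace G]

/-- A bounded operator into a Hilbert space whose values are uniformly approximated, on a dense
set, by finite-dimensional subspaces is compact. -/
theorem isCompactOperator_of_forall_exists_finiteDimensional (T : F →ₗ[ℝ] G) {C : ℝ}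
    (hT : ∀ p, ‖T p‖ ≤ C * ‖p‖) {D : Set F} (hD : Dense D)
    (h : ∀ ε > 0, ∃ V : Submodule ℝ G, FiniteDimensional ℝ V ∧
      ∀ p ∈ D, ∃ v ∈ V, ‖T p - v‖ ≤ ε * ‖p‖) : IsCompactOperator T := by
  set S := T.mkContinuous C hT
  have hmem : S ∈ closure {A : F →L[ℝ] G | IsCompactOperator A} := by
    rw [Metric.mem_closure_iff]
    intro ε hε
    obtain ⟨V, hV, hVD⟩ := h (ε / 2) (half_pos hε)
    -- The projection onto `V` is at least as close as any given `v ∈ V`, so the error bound holds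
    -- on `D`, and on all of `F` because it is a closed condition.
    refine ⟨V.starProjection.comp S, ?_, ?_⟩
    · have h1 := isCompactOperator_of_locallyCompactSpace_dom (V.orthogonalProjectionOnto)
      exact (h1.comp_clm S).continuous_comp V.subtypeL.continuous
    · rw [dist_eq_norm]
      refine (ContinuousLinearMap.opNorm_le_bound _ (half_pos hε).le fun p => ?_).trans_lt
        (half_lt_self hε)
      have hclosed : IsClosed {p | ‖(S - V.starProjection.comp S) p‖ ≤ ε / 2 * ‖p‖} :=
        isClosed_le (by fun_prop) (by fun_prop)
      refine hclosed.closure_subset_iff.2 (fun q hq => ?_) (hD p)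
      obtain ⟨v, hv, hle⟩ := hVD q hq
      refine le_trans ?_ hle
      simp only [sub_apply, ContinuousLinearMap.comp_apply]
      rw [Submodule.starProjection_minimal]
      exact ciInf_le ⟨0, by rintro _ ⟨y, rfl⟩; positivity⟩ (⟨v, hv⟩ : V)
  rwa [IsClosed.closure_eq isClosed_setOfPred_isCompactOperator] at hmem

end FunctionalAnalysis

/-! ### Grids of cubes. -/

section Cubes

variable {N : ℕ}

/-- The half-open cube of side `h` with index `k` in the grid `hℤ^N`. -/
def cube (h : ℝ) (k : Fin N → ℤ) : Set (EuclideanSpace ℝ (Fin N)) :=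
  {x | ∀ i, x i ∈ Set.Ico (k i * h) ((k i + 1) * h)}

/-- Reading the index off by floors makes disjointness and covering immediate. -/
theorem mem_cube_iff {h : ℝ} (hh : 0 < h) {k : Fin N → ℤ} {x : EuclideanSpace ℝ (Fin N)} :
    x ∈ cube h k ↔ (fun i => ⌊x i / h⌋) = k := by
  simp only [cube, Set.mem_ofPred_eq, Set.mem_Ico, funext_iff, Int.floor_eq_iff, le_div_iff₀ hh,
    div_lt_iff₀ hh]

theorem measurableSet_cube (h : ℝ) (k : Fin N → ℤ) : MeasurableSet (cube h k) := by
  have : cube h k = ⋂ i, (fun x : EuclideanSpace ℝ (Fin N) => x i) ⁻¹'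
      Set.Ico (k i * h) ((k i + 1) * h) := by
    ext x; simp [cube]
  rw [this]
  exact .iInter fun i => measurableSet_Ico.preimage (by fun_prop)

theorem convex_cube (h : ℝ) (k : Fin N → ℤ) : Convex ℝ (cube h k) := by
  intro x hx y hy a b ha hb hab i
  exact convex_Ico _ _ (hx i) (hy i) ha hb hab

theorem pairwiseDisjoint_cube {h : ℝ} (hh : 0 < h) (s : Set (Fin N → ℤ)) :
    s.PairwiseDisjoint (cube h) := by
  intro k _ l _ hkl
  refine Set.disjoint_left.2 fun x hk hl => hkl ?_
  rw [← (mem_cube_iff hh).1 hk, (mem_cube_iff hh).1 hl]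

theorem norm_sub_le_of_mem_cube {h : ℝ} (hh : 0 < h) {k : Fin N → ℤ}
    {x y : EuclideanSpace ℝ (Fin N)} (hx : x ∈ cube h k) (hy : y ∈ cube h k) :
    ‖y - x‖ ≤ N * h := by
  refine abs_le_of_sq_le_sq' ?_ (by positivity) |>.2
  rw [EuclideanSpace.norm_sq_eq]
  calc ∑ i, ‖(y - x) i‖ ^ 2 ≤ ∑ i : Fin N, h ^ 2 := by
        refine Finset.sum_le_sum fun i _ => ?_
        have h1 := hx i
        have h2 := hy i
        rw [Set.mem_Ico] at h1 h2
        gcongr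
        rw [PiLp.sub_apply, Real.norm_eq_abs, abs_le]
        constructor <;> linarith
    _ ≤ (N * h) ^ 2 := by
        rw [Finset.sum_const, Finset.card_univ, Fintype.card_fin, nsmul_eq_mul, mul_pow]
        gcongr
        exact_mod_cast Nat.le_self_pow two_ne_zero N

theorem exists_ball_subset_cube {h : ℝ} (k : Fin N → ℤ) :
    ∃ c, Metric.ball c (h / 2) ⊆ cube h k := by
  refine ⟨WithLp.toLp 2 fun i => (k i + 1 / 2) * h, fun x hx i => ?_⟩
  rw [Metric.mem_ball, dist_eq_norm] at hx
  have := (PiLp.norm_apply_le (x - WithLp.toLp 2 fun i => (k i + 1 / 2) * h) i).trans_lt hx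
  rw [PiLp.sub_apply, Real.norm_eq_abs, abs_lt] at this
  simp only at this
  rw [Set.mem_Ico]
  constructor <;> linarith

theorem exists_finset_cube_cover {h : ℝ} (hh : 0 < h) {s : Set (EuclideanSpace ℝ (Fin N))}
    (hs : Bornology.IsBounded s) : ∃ K : Finset (Fin N → ℤ), s ⊆ ⋃ k ∈ K, cube h k := by
  obtain ⟨R, hR⟩ := hs.subset_closedBall 0
  refine ⟨Fintype.piFinset fun _ => Finset.Icc ⌊-R / h⌋ ⌊R / h⌋, fun x hx => ?_⟩
  have hxR := hR hx
  rw [mem_closedBall_zero_iff] at hxR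
  refine Set.mem_biUnion (x := fun i => ⌊x i / h⌋) ?_ ((mem_cube_iff hh).2 rfl)
  simp only [Finset.mem_coe, Fintype.mem_piFinset, Finset.mem_Icc]
  intro i
  have := abs_le.1 ((PiLp.norm_apply_le x i).trans hxR)
  exact ⟨Int.floor_le_floor (by gcongr; exact this.1), Int.floor_le_floor (by gcongr; exact this.2)⟩

/-- Poincaré inequality on the cubes of side `h`, with a constant depending only on `N`. -/
theorem exists_poincare_cube [NeZero N] : ∃ C : ℝ, 0 ≤ C ∧ ∀ h : ℝ, 0 < h → ∀ k : Fin N → ℤ,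
    ∀ φ : EuclideanSpace ℝ (Fin N) → ℝ, ContDiff ℝ 1 φ → ∃ a : ℝ,
      ∫⁻ x in cube h k, ‖φ x - a‖ₑ ^ 2 ≤
        ENNReal.ofReal (C * h ^ 2) * ∫⁻ x in cube h k, ‖fderiv ℝ φ x‖ₑ ^ 2 := by
  have hN : 0 < (N : ℝ) := Nat.cast_pos.2 (NeZero.pos N)
  have : Nontrivial (EuclideanSpace ℝ (Fin N)) := by
    refine ⟨0, EuclideanSpace.single 0 1, fun h => ?_⟩
    simpa using congrArg (fun x => x 0) h
  -- The factor `(2N)^N` bounds the volume ratio of a ball of radius `N h` to the cube, which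
  -- contains a ball of radius `h / 2`; the factor `N²` comes from the crude diameter bound `N h`.
  refine ⟨(2 * N) ^ N * N ^ 2, by positivity, fun h hh k φ hφ => ?_⟩
  obtain ⟨c, hc⟩ := exists_ball_subset_cube (h := h) k
  have hball : volume (Metric.ball c (h / 2)) ≠ 0 :=
    (Metric.measure_ball_pos volume c (half_pos hh)).ne'
  have h0 : volume (cube h k) ≠ 0 := fun h0 => hball (measure_mono_null hc h0)
  have htop : volume (cube h k) ≠ ∞ := by
    have hsub : cube h k ⊆ Metric.closedBall c (N * h) := fun x hx => by
      rw [Metric.mem_closedBall, dist_eq_norm]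
      exact norm_sub_le_of_mem_cube hh (hc (Metric.mem_ball_self (half_pos hh))) hx
    exact ((measure_mono hsub).trans_lt measure_closedBall_lt_top).ne
  obtain ⟨a, ha⟩ := exists_lintegral_enorm_sub_sq_le volume hφ (convex_cube h k)
    (measurableSet_cube h k) (fun x hx y hy => norm_sub_le_of_mem_cube hh hx hy) h0 htop
  refine ⟨a, ha.trans ?_⟩
  rw [← mul_assoc]
  gcongr
  have h1 : volume (Metric.closedBall (0 : EuclideanSpace ℝ (Fin N)) (N * h)) / volume (cube h k) ≤
      ENNReal.ofReal ((2 * N) ^ N) := by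
    rw [ENNReal.div_le_iff h0 htop]
    calc _ = ENNReal.ofReal ((2 * N) ^ N) * volume (Metric.ball c (h / 2)) := by
          rw [Measure.addHaar_closedBall _ _ (by positivity), Measure.addHaar_ball _ c (by positivity),
            ← mul_assoc, ← ENNReal.ofReal_mul (by positivity), finrank_euclideanSpace_fin, ← mul_pow,
            show (2 * N : ℝ) * (h / 2) = N * h by ring]
      _ ≤ _ := by gcongr
  calc _ ≤ ENNReal.ofReal ((2 * N) ^ N) * ENNReal.ofReal (N * h) ^ 2 := by gcongr
    _ = _ := by
      rw [← ENNReal.ofReal_pow (by positivity), ← ENNReal.ofReal_mul (by positivity)]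
      congr 1
      ring

end Cubes

/-! ### The localized weighted Hardy inequality. -/

section Hardy

variable {N : ℕ}

/-- The regularized power `(‖x‖² + ρ²)^β`. -/
def regPow (ρ β : ℝ) (x : EuclideanSpace ℝ (Fin N)) : ℝ := (‖x‖ ^ 2 + ρ ^ 2) ^ β

theorem regPow_pos {ρ : ℝ} (hρ : 0 < ρ) (β : ℝ) (x : EuclideanSpace ℝ (Fin N)) :
    0 < regPow ρ β x := by
  unfold regPow; positivity

theorem continuous_regPow {ρ : ℝ} (hρ : 0 < ρ) (β : ℝ) :
    Continuous (regPow ρ β : EuclideanSpace ℝ (Fin N) → ℝ) := by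
  unfold regPow
  exact Continuous.rpow_const (by fun_prop) fun x => .inl (by positivity)

theorem hasFDerivAt_regPow {ρ : ℝ} (hρ : 0 < ρ) (β : ℝ) (x : EuclideanSpace ℝ (Fin N)) :
    HasFDerivAt (regPow ρ β) ((β * regPow ρ (β - 1) x) • (2 • innerSL ℝ x)) x := by
  have h1 : HasFDerivAt (fun x : EuclideanSpace ℝ (Fin N) => ‖x‖ ^ 2 + ρ ^ 2)
      (2 • innerSL ℝ x) x := (hasStrictFDerivAt_norm_sq x).hasFDerivAt.add_const _
  exact h1.rpow_const (.inl (by positivity))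

/-- The `i`-th partial derivative of `(‖x‖² + ρ²)^β xᵢ`. -/
theorem hasLineDerivAt_regPow_mul_coord {ρ : ℝ} (hρ : 0 < ρ) (β : ℝ) (i : Fin N)
    (x : EuclideanSpace ℝ (Fin N)) :
    HasLineDerivAt ℝ (fun x => regPow ρ β x * x i)
      (regPow ρ β x + 2 * β * regPow ρ (β - 1) x * x i ^ 2) x (EuclideanSpace.single i 1) := by
  have h2 : HasFDerivAt (fun x : EuclideanSpace ℝ (Fin N) => x i)
      (EuclideanSpace.proj (𝕜 := ℝ) i) x := (EuclideanSpace.proj (𝕜 := ℝ) i).hasFDerivAt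
  convert! ((hasFDerivAt_regPow hρ β x).mul h2).hasLineDerivAt (EuclideanSpace.single i 1) using 1
  simp [EuclideanSpace.inner_single_right]
  ring

/-- Since `‖x‖² ≤ ‖x‖² + ρ²` and `α - 2 < 0`, the divergence is at least `(N + α - 2)` times the
regularized power, and `N ≥ 2`. -/
theorem mul_regPow_le_divergence (hN : 2 ≤ N) {α ρ : ℝ} (hα2 : α < 2) (hρ : 0 < ρ)
    (x : EuclideanSpace ℝ (Fin N)) :
    α * regPow ρ ((α - 2) / 2) x ≤ ∑ i, (regPow ρ ((α - 2) / 2) x +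
      2 * ((α - 2) / 2) * regPow ρ ((α - 2) / 2 - 1) x * x i ^ 2) := by
  rw [Finset.sum_add_distrib, ← Finset.mul_sum, ← EuclideanSpace.real_norm_sq_eq, Finset.sum_const,
    Finset.card_univ, Fintype.card_fin, nsmul_eq_mul]
  have hN' : (2 : ℝ) ≤ N := by exact_mod_cast hN
  have h1 : regPow ρ ((α - 2) / 2) x = regPow ρ ((α - 2) / 2 - 1) x * (‖x‖ ^ 2 + ρ ^ 2) := by
    unfold regPow
    rw [Real.rpow_sub_one (by positivity)]
    field_simp
  have h2 := regPow_pos hρ ((α - 2) / 2 - 1) x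
  have h3 := regPow_pos hρ ((α - 2) / 2) x
  have h4 : regPow ρ ((α - 2) / 2 - 1) x * ‖x‖ ^ 2 ≤ regPow ρ ((α - 2) / 2) x := by
    rw [h1]; gcongr; nlinarith
  nlinarith [mul_nonneg (sub_nonneg.2 h4) (sub_nonneg.2 hα2.le),
    mul_nonneg (sub_nonneg.2 hN') h3.le]

/-- Dropping `ρ²` increases a negative power, and `2 + (α - 2) = α`. At the origin both sides
vanish. -/
theorem norm_sq_mul_regPow_le_weight {α ρ : ℝ} (hα0 : 0 < α) (hα2 : α < 2)
    (x : EuclideanSpace ℝ (Fin N)) :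
    ‖x‖ ^ 2 * regPow ρ ((α - 2) / 2) x ≤ weight α x := by
  rcases eq_or_ne x 0 with rfl | hx
  · simp [weight, hα0.ne']
  have hx' : 0 < ‖x‖ := norm_pos_iff.2 hx
  calc ‖x‖ ^ 2 * regPow ρ ((α - 2) / 2) x ≤ ‖x‖ ^ 2 * (‖x‖ ^ 2) ^ ((α - 2) / 2) := by
        unfold regPow
        gcongr ?_ * ?_
        exact Real.rpow_le_rpow_of_nonpos (by positivity) (by nlinarith [sq_nonneg ρ]) (by linarith)
    _ = weight α x := by
        unfold weight
        rw [← Real.rpow_natCast, ← Real.rpow_mul hx'.le, ← Real.rpow_add hx']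
        congr 1
        push_cast
        ring

theorem continuous_weight {α : ℝ} (hα0 : 0 < α) :
    Continuous (weight α : EuclideanSpace ℝ (Fin N) → ℝ) := by
  unfold weight
  exact continuous_norm.rpow_const fun _ => .inr hα0.le

theorem weight_nonneg (α : ℝ) (x : EuclideanSpace ℝ (Fin N)) : 0 ≤ weight α x := by
  unfold weight; positivity

/-- Integration by parts against the vector field `(‖x‖² + ρ²)^β x`. -/
theorem integral_sq_mul_divergence {φ : EuclideanSpace ℝ (Fin N) → ℝ} (hφ : ContDiff ℝ 1 φ)
    (hc : HasCompactSupport φ) {ρ : ℝ} (hρ : 0 < ρ) (β : ℝ) :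
    ∫ x, φ x ^ 2 * ∑ i, (regPow ρ β x + 2 * β * regPow ρ (β - 1) x * x i ^ 2) =
      - ∫ x, 2 * φ x * fderiv ℝ φ x x * regPow ρ β x := by
  have hφc := hφ.continuous
  have hD := hφ.continuous_fderiv one_ne_zero
  have hr := continuous_regPow (N := N) hρ β
  have hr1 := continuous_regPow (N := N) hρ (β - 1)
  have hint : ∀ ψ : EuclideanSpace ℝ (Fin N) → ℝ, Continuous ψ → Integrable fun x => φ x * ψ x :=
    fun ψ hψ => (hφc.mul hψ).integrable_of_hasCompactSupport hc.mul_right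
  have hDi : ∀ i, Continuous fun x => fderiv ℝ φ x (EuclideanSpace.single i 1) :=
    fun i => hD.clm_apply continuous_const
  have hI1 : ∀ i, Integrable fun x =>
      φ x ^ 2 * (regPow ρ β x + 2 * β * regPow ρ (β - 1) x * x i ^ 2) := fun i => by
    refine (hint (fun x => φ x * (regPow ρ β x + 2 * β * regPow ρ (β - 1) x * x i ^ 2))
      (by fun_prop)).congr (.of_forall fun x => ?_)
    simp only; ring
  have hI2 : ∀ i, Integrable fun x =>
      2 * φ x * fderiv ℝ φ x (EuclideanSpace.single i 1) * (regPow ρ β x * x i) := fun i => by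
    have := hDi i
    refine (hint (fun x => 2 * fderiv ℝ φ x (EuclideanSpace.single i 1) * (regPow ρ β x * x i))
      (by fun_prop)).congr (.of_forall fun x => ?_)
    simp only; ring
  have hI3 : ∀ i, Integrable fun x => φ x ^ 2 * (regPow ρ β x * x i) := fun i => by
    refine (hint (fun x => φ x * (regPow ρ β x * x i))
      (by fun_prop)).congr (.of_forall fun x => ?_)
    simp only; ring
  have hibp : ∀ i, ∫ x, φ x ^ 2 * (regPow ρ β x + 2 * β * regPow ρ (β - 1) x * x i ^ 2) =
      - ∫ x, 2 * φ x * fderiv ℝ φ x (EuclideanSpace.single i 1) * (regPow ρ β x * x i) := fun i =>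
    -- The parameter `ρ > 0` keeps the field smooth at the origin, so no ball has to be excised.
    integral_bilinear_hasLineDerivAt_right_eq_neg_left_of_integrable
      (B := ContinuousLinearMap.mul ℝ ℝ) (hI2 i) (hI1 i) (hI3 i)
      (fun x _ => by
        convert! ((hφ.differentiable one_ne_zero x).hasFDerivAt.pow 2).hasLineDerivAt
          (EuclideanSpace.single i 1) using 1
        simp)
      (fun x _ => hasLineDerivAt_regPow_mul_coord hρ β i x)
  simp_rw [Finset.mul_sum]
  rw [integral_finsetSum _ fun i _ => hI1 i]
  simp_rw [hibp]
  rw [Finset.sum_neg_distrib, ← integral_finsetSum _ fun i _ => hI2 i]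
  congr 1
  refine integral_congr_ae (.of_forall fun x => ?_)
  have hx : fderiv ℝ φ x x = ∑ i, x i * fderiv ℝ φ x (EuclideanSpace.single i 1) := by
    generalize fderiv ℝ φ x = L
    conv_lhs => rw [← (EuclideanSpace.basisFun (Fin N) ℝ).sum_repr x, map_sum]
    simp
  simp only [hx, Finset.mul_sum, Finset.sum_mul]
  exact Finset.sum_congr rfl fun i _ => by ring

/-- Hardy inequality with weight `|x|^α`, in a form localized at the scale `ρ`. -/
theorem setIntegral_closedBall_sq_le (hN : 2 ≤ N) {α : ℝ} (hα0 : 0 < α) (hα2 : α < 2)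
    {φ : EuclideanSpace ℝ (Fin N) → ℝ} (hφ : ContDiff ℝ 1 φ) (hc : HasCompactSupport φ)
    {ρ : ℝ} (hρ : 0 < ρ) :
    ∫ x in Metric.closedBall 0 ρ, φ x ^ 2 ≤
      (2 * ρ ^ 2) ^ ((2 - α) / 2) * (4 / α ^ 2) * ∫ x, ‖fderiv ℝ φ x‖ ^ 2 * weight α x := by
  set β := (α - 2) / 2 with hβ
  have hφc := hφ.continuous
  have hD := hφ.continuous_fderiv one_ne_zero
  have hr := continuous_regPow (N := N) hρ β
  have hr1 := continuous_regPow (N := N) hρ (β - 1)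
  have hw := continuous_weight (N := N) hα0
  have hint : ∀ ψ : EuclideanSpace ℝ (Fin N) → ℝ, Continuous ψ →
      Integrable fun x => φ x ^ 2 * ψ x := fun ψ hψ => by
    simp_rw [pow_two, mul_assoc]
    exact (by fun_prop : Continuous fun x =>
      φ x * (φ x * ψ x)).integrable_of_hasCompactSupport hc.mul_right
  have hA : Integrable fun x => φ x ^ 2 * regPow ρ β x := hint _ hr
  have hB : Integrable fun x => ‖fderiv ℝ φ x‖ ^ 2 * weight α x := by
    simp_rw [pow_two, mul_assoc]
    exact (by fun_prop : Continuous fun x =>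
      ‖fderiv ℝ φ x‖ * (‖fderiv ℝ φ x‖ * weight α x)).integrable_of_hasCompactSupport
      (hc.fderiv ℝ).norm.mul_right
  have hDx : Continuous fun x => fderiv ℝ φ x x := hD.clm_apply continuous_id
  have hC : Integrable fun x => 2 * φ x * fderiv ℝ φ x x * regPow ρ β x :=
    (by fun_prop : Continuous fun x =>
      2 * φ x * fderiv ℝ φ x x * regPow ρ β x).integrable_of_hasCompactSupport
      (((hc.mul_left).mul_right).mul_right)
  have hlow : α * ∫ x, φ x ^ 2 * regPow ρ β x ≤
      ∫ x, φ x ^ 2 * ∑ i, (regPow ρ β x + 2 * β * regPow ρ (β - 1) x * x i ^ 2) := by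
    rw [← integral_const_mul]
    refine integral_mono (hA.const_mul α) (hint _ (by fun_prop)) fun x => ?_
    have := mul_le_mul_of_nonneg_left (mul_regPow_le_divergence hN hα2 hρ x) (sq_nonneg (φ x))
    simp only
    linarith
  have hup : - ∫ x, 2 * φ x * fderiv ℝ φ x x * regPow ρ β x ≤
      α / 2 * (∫ x, φ x ^ 2 * regPow ρ β x) +
        2 / α * ∫ x, ‖fderiv ℝ φ x‖ ^ 2 * weight α x := by
    rw [← integral_neg, ← integral_const_mul, ← integral_const_mul,
      ← integral_add (hA.const_mul _) (hB.const_mul _)]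
    refine integral_mono hC.neg ((hA.const_mul _).add (hB.const_mul _)) fun x => ?_
    have h1 : fderiv ℝ φ x x ^ 2 * regPow ρ β x ≤ ‖fderiv ℝ φ x‖ ^ 2 * weight α x := by
      calc fderiv ℝ φ x x ^ 2 * regPow ρ β x
          ≤ (‖fderiv ℝ φ x‖ * ‖x‖) ^ 2 * regPow ρ β x := by
            have := regPow_pos hρ β x
            gcongr ?_ * _
            rw [← sq_abs]
            gcongr
            exact (fderiv ℝ φ x).le_opNorm x
        _ = ‖fderiv ℝ φ x‖ ^ 2 * (‖x‖ ^ 2 * regPow ρ β x) := by ring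
        _ ≤ _ := by gcongr; exact norm_sq_mul_regPow_le_weight hα0 hα2 x
    -- Young's inequality with weight `α / 2`, so that half of the lower bound `α ∫ φ² (‖x‖² +
    -- ρ²)^β` absorbs the first term.
    have h2 : - (2 * φ x * fderiv ℝ φ x x) ≤ α / 2 * φ x ^ 2 + 2 / α * fderiv ℝ φ x x ^ 2 := by
      have h3 : α / 2 * φ x ^ 2 + 2 / α * fderiv ℝ φ x x ^ 2 + 2 * φ x * fderiv ℝ φ x x =
          (2 * α)⁻¹ * (α * φ x + 2 * fderiv ℝ φ x x) ^ 2 := by field_simp; ring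
      have h4 : 0 ≤ (2 * α)⁻¹ * (α * φ x + 2 * fderiv ℝ φ x x) ^ 2 := by positivity
      linarith
    calc -(2 * φ x * fderiv ℝ φ x x * regPow ρ β x)
        = -(2 * φ x * fderiv ℝ φ x x) * regPow ρ β x := by ring
      _ ≤ (α / 2 * φ x ^ 2 + 2 / α * fderiv ℝ φ x x ^ 2) * regPow ρ β x :=
          mul_le_mul_of_nonneg_right h2 (regPow_pos hρ β x).le
      _ = α / 2 * (φ x ^ 2 * regPow ρ β x) + 2 / α * (fderiv ℝ φ x x ^ 2 * regPow ρ β x) := by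
          ring
      _ ≤ _ := by gcongr
  rw [integral_sq_mul_divergence hφ hc hρ β] at hlow
  have hAB : ∫ x, φ x ^ 2 * regPow ρ β x ≤
      4 / α ^ 2 * ∫ x, ‖fderiv ℝ φ x‖ ^ 2 * weight α x := by
    have h1 : α / 2 * ∫ x, φ x ^ 2 * regPow ρ β x ≤
        α / 2 * (4 / α ^ 2 * ∫ x, ‖fderiv ℝ φ x‖ ^ 2 * weight α x) := by
      rw [← mul_assoc, show α / 2 * (4 / α ^ 2) = 2 / α by field_simp; ring]
      linarith
    exact le_of_mul_le_mul_left h1 (half_pos hα0)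
  have hexp : (2 - α) / 2 = -β := by rw [hβ]; ring
  rw [hexp, mul_assoc]
  calc ∫ x in Metric.closedBall 0 ρ, φ x ^ 2
      ≤ ∫ x in Metric.closedBall 0 ρ, (2 * ρ ^ 2) ^ (-β) * (φ x ^ 2 * regPow ρ β x) := by
        refine setIntegral_mono_on ?_ (hA.const_mul _).integrableOn
          Metric.isClosed_closedBall.measurableSet fun x hx => ?_
        · simpa using (hint (fun _ => 1) continuous_const).integrableOn
        · rw [mem_closedBall_zero_iff] at hx
          -- In the ball `‖x‖² + ρ² ≤ 2ρ²`, and `β` is negative.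
          have h1 : (2 * ρ ^ 2) ^ β ≤ regPow ρ β x :=
            Real.rpow_le_rpow_of_nonpos (by positivity) (by nlinarith [norm_nonneg x])
              (by rw [hβ]; linarith)
          have h2 : 1 ≤ (2 * ρ ^ 2) ^ (-β) * regPow ρ β x := by
            calc 1 = (2 * ρ ^ 2) ^ (-β) * (2 * ρ ^ 2) ^ β := by
                  rw [← Real.rpow_add (by positivity)]; simp
              _ ≤ _ := by gcongr
          nlinarith [mul_le_mul_of_nonneg_left h2 (sq_nonneg (φ x))]
    _ ≤ ∫ x, (2 * ρ ^ 2) ^ (-β) * (φ x ^ 2 * regPow ρ β x) :=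
        setIntegral_le_integral (hA.const_mul _) (.of_forall fun x => by
          have := regPow_pos hρ β x
          simp only [Pi.zero_apply]
          positivity)
    _ ≤ _ := by
        rw [integral_const_mul]
        gcongr

end Hardy

/-! ### Weak gradients: uniqueness and the smooth case. -/

section WeakGradient

variable {N : ℕ}

/-- Each coordinate of the difference integrates to zero against all test functions, so the
fundamental lemma of the calculus of variations applies. -/
theorem IsWeakGradient.unique {Ω : Opens (EuclideanSpace ℝ (Fin N))}
    {u : EuclideanSpace ℝ (Fin N) → ℝ}
    {g h : EuclideanSpace ℝ (Fin N) → EuclideanSpace ℝ (Fin N)}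
    (hg : IsWeakGradient Ω u g) (hh : IsWeakGradient Ω u h) :
    g =ᵐ[volume.restrict (Ω : Set (EuclideanSpace ℝ (Fin N)))] h := by
  have hcoord : ∀ i, ∀ᵐ x ∂(volume : Measure (EuclideanSpace ℝ (Fin N))),
      x ∈ Ω → g x i - h x i = 0 := fun i => by
    refine Ω.isOpen.ae_eq_zero_of_integral_contDiff_smul_eq_zero
      ((locallyIntegrableOn_coord hg.2.1 i).sub (locallyIntegrableOn_coord hh.2.1 i))
      fun ψ hψ hψc hψs => ?_
    let φ : 𝓓(Ω, ℝ) := ⟨ψ, hψ, hψc, hψs⟩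
    have h1 := integrable_coord_mul hg.2.1 φ i
    have h2 := integrable_coord_mul hh.2.1 φ i
    have h3 : ∫ x in Ω, g x i * φ x = ∫ x in Ω, h x i * φ x :=
      neg_injective ((hg.2.2 i φ).symm.trans (hh.2.2 i φ))
    calc ∫ x, ψ x • (g x i - h x i) = ∫ x in Ω, ψ x • (g x i - h x i) := by
          refine (setIntegral_eq_integral_of_forall_compl_eq_zero fun x hx => ?_).symm
          rw [image_eq_zero_of_notMem_tsupport fun hx' => hx (hψs hx'), zero_smul]
      _ = ∫ x in Ω, (g x i * φ x - h x i * φ x) := by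
          refine integral_congr_ae (.of_forall fun x => ?_)
          simp only [smul_eq_mul]
          change ψ x * _ = g x i * ψ x - h x i * ψ x
          ring
      _ = 0 := by rw [integral_sub h1 h2, h3, sub_self]
  refine (ae_restrict_iff' Ω.isOpen.measurableSet).2 ?_
  filter_upwards [ae_all_iff.2 hcoord] with x hx hxΩ
  ext i
  exact sub_eq_zero.1 (hx i hxΩ)

theorem isWeakGradient_gradient (Ω : Opens (EuclideanSpace ℝ (Fin N)))
    {φ : EuclideanSpace ℝ (Fin N) → ℝ} (hφ : ContDiff ℝ 1 φ) :
    IsWeakGradient Ω φ (gradient φ) := by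
  have hD := hφ.continuous_fderiv one_ne_zero
  have hφc := hφ.continuous
  have hG : Continuous (gradient φ) :=
    (InnerProductSpace.toDual ℝ (EuclideanSpace ℝ (Fin N))).symm.continuous.comp hD
  refine ⟨(hφc.locallyIntegrable).locallyIntegrableOn _,
    (hG.locallyIntegrable).locallyIntegrableOn _, fun i ψ => ?_⟩
  have hψ : ContDiff ℝ 1 ψ := ψ.contDiff.of_le (by exact_mod_cast le_top)
  have hψc := hψ.continuous
  have hDψ := hψ.continuous_fderiv one_ne_zero
  have hcoord : ∀ x, gradient φ x i = fderiv ℝ φ x (EuclideanSpace.single i 1) := fun x => by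
    rw [← inner_gradient_left, EuclideanSpace.inner_single_right]
    simp
  have hout : ∀ x ∉ (Ω : Set (EuclideanSpace ℝ (Fin N))), x ∉ tsupport ψ :=
    fun x hx hx' => hx (ψ.tsupport_subset hx')
  have hc1 : Continuous fun x => fderiv ℝ φ x (EuclideanSpace.single i 1) :=
    hD.clm_apply continuous_const
  have hc2 : Continuous fun x => fderiv ℝ ψ x (EuclideanSpace.single i 1) :=
    hDψ.clm_apply continuous_const
  simp_rw [hcoord]
  rw [setIntegral_eq_integral_of_forall_compl_eq_zero fun x hx => ?_,
    setIntegral_eq_integral_of_forall_compl_eq_zero fun x hx => ?_]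
  · exact integral_mul_fderiv_eq_neg_fderiv_mul_of_integrable
      ((hc1.mul hψc).integrable_of_hasCompactSupport ψ.hasCompactSupport.mul_left)
      ((hφc.mul hc2).integrable_of_hasCompactSupport
        (ψ.hasCompactSupport.fderiv_apply ℝ _).mul_left)
      ((hφc.mul hψc).integrable_of_hasCompactSupport ψ.hasCompactSupport.mul_left)
      (fun x _ => hφ.differentiable one_ne_zero x) (fun x _ => hψ.differentiable one_ne_zero x)
  · rw [image_eq_zero_of_notMem_tsupport (hout x hx), mul_zero]
  · rw [fderiv_of_notMem_tsupport (𝕜 := ℝ) (hout x hx), zero_apply, mul_zero]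

end WeakGradient

/-! ### Energy estimates and the bound into `L²(Ω)`. -/

section Energy

variable {N : ℕ}

/-- The weighted Dirichlet energy `∫ |∇φ|² w dx`. -/
def energy (α : ℝ) (φ : EuclideanSpace ℝ (Fin N) → ℝ) : ℝ≥0∞ :=
  ∫⁻ x, ‖fderiv ℝ φ x‖ₑ ^ 2 * ENNReal.ofReal (weight α x)

theorem enorm_sq_eq_lintegral {X F : Type*} [MeasurableSpace X] {μ : Measure X}
    [NormedAddCommGroup F] (f : Lp F 2 μ) : ‖f‖ₑ ^ 2 = ∫⁻ x, ‖f x‖ₑ ^ 2 ∂μ := by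
  have h := eLpNorm_nnreal_pow_eq_lintegral (μ := μ) (f := f) (p := 2) two_ne_zero
  rw [Lp.enorm_def]
  simpa only [NNReal.coe_ofNat, ENNReal.coe_ofNat, ENNReal.rpow_ofNat] using h

theorem weightMeasure_absolutelyContinuous (Ω : Opens (EuclideanSpace ℝ (Fin N))) (α : ℝ) :
    weightMeasure Ω α ≪ volume.restrict (Ω : Set (EuclideanSpace ℝ (Fin N))) :=
  withDensity_absolutelyContinuous _ _

/-- The constant of the localized Hardy inequality. -/
def hardyConst (α ρ : ℝ) : ℝ := (2 * ρ ^ 2) ^ ((2 - α) / 2) * (4 / α ^ 2)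

theorem setLIntegral_closedBall_enorm_sq_le (hN : 2 ≤ N) {α : ℝ} (hα0 : 0 < α) (hα2 : α < 2)
    {φ : EuclideanSpace ℝ (Fin N) → ℝ} (hφ : ContDiff ℝ 1 φ) (hc : HasCompactSupport φ)
    {ρ : ℝ} (hρ : 0 < ρ) :
    ∫⁻ x in Metric.closedBall 0 ρ, ‖φ x‖ₑ ^ 2 ≤
      ENNReal.ofReal (hardyConst α ρ) * energy α φ := by
  have hφc := hφ.continuous
  have hD := hφ.continuous_fderiv one_ne_zero
  have hw := continuous_weight (N := N) hα0
  have hA : Integrable fun x => φ x ^ 2 := by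
    simp_rw [pow_two]
    exact (hφc.mul hφc).integrable_of_hasCompactSupport hc.mul_right
  have hB : Integrable fun x => ‖fderiv ℝ φ x‖ ^ 2 * weight α x := by
    simp_rw [pow_two, mul_assoc]
    exact (by fun_prop : Continuous fun x =>
      ‖fderiv ℝ φ x‖ * (‖fderiv ℝ φ x‖ * weight α x)).integrable_of_hasCompactSupport
      (hc.fderiv ℝ).norm.mul_right
  have h1 : ∫⁻ x in Metric.closedBall 0 ρ, ‖φ x‖ₑ ^ 2 =
      ENNReal.ofReal (∫ x in Metric.closedBall 0 ρ, φ x ^ 2) := by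
    rw [ofReal_integral_eq_lintegral_ofReal hA.integrableOn (.of_forall fun x => sq_nonneg _)]
    refine lintegral_congr fun x => ?_
    rw [← ofReal_norm, ← ENNReal.ofReal_pow (norm_nonneg _), Real.norm_eq_abs, sq_abs]
  have h2 : energy α φ = ENNReal.ofReal (∫ x, ‖fderiv ℝ φ x‖ ^ 2 * weight α x) := by
    rw [ofReal_integral_eq_lintegral_ofReal hB (.of_forall fun x =>
      mul_nonneg (sq_nonneg _) (weight_nonneg α x)), energy]
    refine lintegral_congr fun x => ?_
    rw [← ofReal_norm, ← ENNReal.ofReal_pow (norm_nonneg _), ENNReal.ofReal_mul (by positivity)]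
  rw [h1, h2, ← ENNReal.ofReal_mul (by unfold hardyConst; positivity)]
  exact ENNReal.ofReal_le_ofReal (setIntegral_closedBall_sq_le hN hα0 hα2 hφ hc hρ)

theorem norm_le_of_enorm_sq_le {F G : Type*} [NormedAddCommGroup F] [NormedAddCommGroup G]
    {x : F} {y : G} {c : ℝ} (hc : 0 ≤ c) (h : ‖x‖ₑ ^ 2 ≤ ENNReal.ofReal (c ^ 2) * ‖y‖ₑ ^ 2) :
    ‖x‖ ≤ c * ‖y‖ := by
  rw [← ofReal_norm, ← ofReal_norm, ← ENNReal.ofReal_pow (norm_nonneg _),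
    ← ENNReal.ofReal_pow (norm_nonneg _), ← ENNReal.ofReal_mul (sq_nonneg _), ← mul_pow,
    ENNReal.ofReal_le_ofReal_iff (by positivity)] at h
  exact (abs_le_of_sq_le_sq' h (by positivity)).2

variable [NeZero N]

/-- The second component is forced by uniqueness of weak gradients; this is the source of
injectivity. -/
theorem H1.ext_fst {Ω : Opens (EuclideanSpace ℝ (Fin N))} {α : ℝ} {p q : H1 Ω α}
    (h : p.1.fst =ᵐ[volume.restrict (Ω : Set (EuclideanSpace ℝ (Fin N)))] q.1.fst) : p = q := by
  have hgrad := (p.2.2.congr h .rfl).unique q.2.2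
  have hac := weightMeasure_absolutelyContinuous Ω α
  exact Subtype.ext (WithLp.ofLp_injective 2 (Prod.ext (Lp.ext (hac.ae_eq h))
    (Lp.ext (hac.ae_eq hgrad))))

/-- By uniqueness the second component of `p` is the classical gradient of `φ`, which vanishes
outside `Ω`; its weighted norm is one of the two terms of `‖p‖²`. -/
theorem energy_le_enorm_sq {Ω : Opens (EuclideanSpace ℝ (Fin N))} {α : ℝ}
    {p : H1 Ω α} {φ : 𝓓(Ω, ℝ)} (hp : p.1.fst =ᵐ[weightMeasure Ω α] φ) :
    energy α φ ≤ ‖p‖ₑ ^ 2 := by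
  have hφ : ContDiff ℝ 1 φ := φ.contDiff.of_le (by exact_mod_cast le_top)
  have hgrad := (p.2.2.congr ((volume_absolutelyContinuous Ω α).ae_eq hp) .rfl).unique
    (isWeakGradient_gradient Ω hφ)
  have hsnd : ‖p.1.snd‖ₑ ≤ ‖p‖ₑ := by
    rw [← ofReal_norm, ← ofReal_norm]
    refine ENNReal.ofReal_le_ofReal (abs_le_of_sq_le_sq' ?_ (norm_nonneg _)).2
    rw [Submodule.coe_norm, WithLp.prod_norm_sq_eq_of_L2]
    exact le_add_of_nonneg_left (sq_nonneg _)
  refine le_trans (le_of_eq ?_) (pow_le_pow_left' hsnd 2)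
  have hwm : Measurable fun x : EuclideanSpace ℝ (Fin N) => ENNReal.ofReal (weight α x) := by
    unfold weight; fun_prop
  rw [enorm_sq_eq_lintegral]
  refine Eq.trans ?_ (lintegral_withDensity_eq_lintegral_mul_non_measurable
    (volume.restrict (Ω : Set (EuclideanSpace ℝ (Fin N)))) hwm (by simp)
    fun x => ‖p.1.snd x‖ₑ ^ 2).symm
  rw [energy, ← setLIntegral_eq_of_support_subset (s := (Ω : Set (EuclideanSpace ℝ (Fin N))))]
  · refine lintegral_congr_ae ?_
    filter_upwards [hgrad] with x hx
    rw [Pi.mul_apply, hx, mul_comm, gradient, LinearIsometryEquiv.enorm_map]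
  · intro x hx
    by_contra hxΩ
    refine hx ?_
    have hz : ‖fderiv ℝ φ x‖ₑ = 0 := by
      rw [← ofReal_norm, fderiv_of_notMem_tsupport (𝕜 := ℝ) fun h => hxΩ (φ.tsupport_subset h),
        norm_zero, ENNReal.ofReal_zero]
    simp [hz]

theorem enorm_toL2_sq {Ω : Opens (EuclideanSpace ℝ (Fin N))} {α : ℝ} (p : H1 Ω α) :
    ‖toL2 Ω α p‖ₑ ^ 2 = ∫⁻ x in Ω, ‖p.1.fst x‖ₑ ^ 2 := by
  rw [enorm_sq_eq_lintegral]
  refine lintegral_congr_ae ?_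
  filter_upwards [p.2.1.coeFn_toLp] with x hx
  change ‖(p.2.1.toLp) x‖ₑ ^ 2 = _
  rw [hx]

/-- The Hardy inequality at the scale of a ball containing `Ω`. -/
theorem exists_norm_toL2_le_of_mem_testSubmodule (hN : 2 ≤ N) {α : ℝ} (hα0 : 0 < α) (hα2 : α < 2)
    {Ω : Opens (EuclideanSpace ℝ (Fin N))}
    (hΩb : Bornology.IsBounded (Ω : Set (EuclideanSpace ℝ (Fin N)))) :
    ∃ C : ℝ, 0 ≤ C ∧ ∀ p ∈ testSubmodule Ω α, ‖toL2 Ω α p‖ ≤ C * ‖p‖ := by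
  obtain ⟨R, hR0, hR⟩ := hΩb.subset_closedBall_lt 0 0
  refine ⟨√(hardyConst α R), Real.sqrt_nonneg _, ?_⟩
  rintro p ⟨φ, hp⟩
  have hφ : ContDiff ℝ 1 φ := φ.contDiff.of_le (by exact_mod_cast le_top)
  refine norm_le_of_enorm_sq_le (Real.sqrt_nonneg _) ?_
  rw [Real.sq_sqrt (by unfold hardyConst; positivity), enorm_toL2_sq]
  calc ∫⁻ x in Ω, ‖p.1.fst x‖ₑ ^ 2 = ∫⁻ x in Ω, ‖φ x‖ₑ ^ 2 := by
        refine lintegral_congr_ae ?_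
        filter_upwards [(volume_absolutelyContinuous Ω α).ae_eq hp] with x hx
        rw [hx]
    _ ≤ ∫⁻ x in Metric.closedBall 0 R, ‖φ x‖ₑ ^ 2 := lintegral_mono_set hR
    _ ≤ ENNReal.ofReal (hardyConst α R) * energy α φ :=
        setLIntegral_closedBall_enorm_sq_le hN hα0 hα2 hφ φ.hasCompactSupport hR0
    _ ≤ _ := by gcongr; exact energy_le_enorm_sq hp

/-- Bounds for `u ↦ u` into `L²(Ω)` extend from a set to its closure, by Fatou's lemma. -/
theorem norm_toL2_le_of_mem_closure {Ω : Opens (EuclideanSpace ℝ (Fin N))} {α C : ℝ} (hC : 0 ≤ C)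
    {S : Set (H1 Ω α)} (hS : ∀ p ∈ S, ‖toL2 Ω α p‖ ≤ C * ‖p‖) {p : H1 Ω α} (hp : p ∈ closure S) :
    ‖toL2 Ω α p‖ ≤ C * ‖p‖ := by
  obtain ⟨q, hqS, hq⟩ := mem_closure_iff_seq_limit.1 hp
  have hfst : Filter.Tendsto (fun n => (q n).1.fst) Filter.atTop (nhds p.1.fst) :=
    ((by fun_prop : Continuous fun r : H1 Ω α => r.1.fst).tendsto p).comp hq
  -- The convergence is in the weighted space; a subsequence converges almost everywhere, and the
  -- weighted null sets are Lebesgue null in `Ω`.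
  obtain ⟨ns, hns, hae⟩ := (tendstoInMeasure_of_tendsto_Lp hfst).exists_seq_tendsto_ae
  have hfatou := Lp.eLpNorm_lim_le_liminf_eLpNorm (p := 2)
    (fun n => (q (ns n)).2.1.aestronglyMeasurable) p.1.fst ((volume_absolutelyContinuous Ω α) hae)
  have hnorm : ∀ r : H1 Ω α, eLpNorm r.1.fst 2 (volume.restrict (Ω : Set _)) = ‖toL2 Ω α r‖ₑ :=
    fun r => (Lp.enorm_toLp r.2.1).symm
  simp_rw [hnorm] at hfatou
  have hlim : Filter.Tendsto (fun n => ENNReal.ofReal (C * ‖q (ns n)‖)) Filter.atTop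
      (nhds (ENNReal.ofReal (C * ‖p‖))) :=
    ENNReal.tendsto_ofReal (((hq.comp hns.tendsto_atTop).norm).const_mul C)
  have hle := hfatou.trans ((Filter.liminf_le_liminf (.of_forall fun n => ?_)).trans_eq
    hlim.liminf_eq)
  · rwa [← ofReal_norm, ENNReal.ofReal_le_ofReal_iff (by positivity)] at hle
  · rw [← ofReal_norm]
    exact ENNReal.ofReal_le_ofReal (hS _ (hqS _))

end Energy

/-! ### Step-function approximation and conclusion. -/

section Compactness

variable {N : ℕ} [NeZero N]

/-- For `α < 2` the exponent `(2 - α) / 2` is positive, so the constant tends to `0` with `ρ`. -/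
theorem exists_hardyConst_le {α : ℝ} (hα2 : α < 2) {ε : ℝ} (hε : 0 < ε) :
    ∃ ρ > 0, hardyConst α ρ ≤ ε := by
  have hcont : Continuous (hardyConst α) := by
    unfold hardyConst
    exact ((by fun_prop : Continuous fun ρ : ℝ => 2 * ρ ^ 2).rpow_const
      fun _ => .inr (by linarith)).mul_const _
  have h0 : hardyConst α 0 = 0 := by
    rw [hardyConst, zero_pow two_ne_zero, mul_zero, Real.zero_rpow (by linarith), zero_mul]
  have hev : ∀ᶠ ρ in nhds 0, hardyConst α ρ < ε :=
    hcont.continuousAt.eventually_lt continuousAt_const (by rwa [h0])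
  obtain ⟨δ, hδ, h⟩ := Metric.eventually_nhds_iff.1 hev
  refine ⟨δ / 2, half_pos hδ, (h ?_).le⟩
  rw [Real.dist_eq, sub_zero, abs_of_pos (half_pos hδ)]
  exact half_lt_self hδ

/-- Local approximation by constants: away from the origin by the Poincaré inequality, near the
origin, where the constant is `0`, by restriction to a small ball. -/
theorem exists_cube_approximation {α : ℝ} (hα0 : 0 < α) {ρ ε : ℝ} (hρ : 0 < ρ)
    (hε : 0 < ε) :
    ∃ h : ℝ, 0 < h ∧ ∀ φ : EuclideanSpace ℝ (Fin N) → ℝ, ContDiff ℝ 1 φ → ∀ k : Fin N → ℤ, ∃ a : ℝ,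
      ∫⁻ x in cube h k, ‖φ x - a‖ₑ ^ 2 ≤ ∫⁻ x in cube h k,
        (ENNReal.ofReal ε * (‖fderiv ℝ φ x‖ₑ ^ 2 * ENNReal.ofReal (weight α x)) +
          (Metric.closedBall 0 ρ).indicator (fun x => ‖φ x‖ₑ ^ 2) x) := by
  obtain ⟨C, hC0, hC⟩ := exists_poincare_cube (N := N)
  -- The first bound puts every cube meeting the ball of radius `ρ / 2` inside the ball of radius
  -- `ρ`. On the remaining cubes the weight is at least `(ρ / 2)^α`, and the second bound gives `C
  -- h² ≤ ε |x|^α`.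
  obtain ⟨h, hh, hhρ, hhε⟩ : ∃ h : ℝ, 0 < h ∧ N * h ≤ ρ / 2 ∧ C * h ^ 2 ≤ ε * (ρ / 2) ^ α := by
    have h1 : ∀ᶠ h : ℝ in nhds 0, (N : ℝ) * h < ρ / 2 :=
      (by fun_prop : Continuous fun h : ℝ => (N : ℝ) * h).continuousAt.eventually_lt
        continuousAt_const (by simpa using half_pos hρ)
    have h2 : ∀ᶠ h : ℝ in nhds 0, C * h ^ 2 < ε * (ρ / 2) ^ α :=
      (by fun_prop : Continuous fun h : ℝ => C * h ^ 2).continuousAt.eventually_lt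
        continuousAt_const (by rw [zero_pow two_ne_zero, mul_zero]; positivity)
    obtain ⟨δ, hδ, h⟩ := Metric.eventually_nhds_iff.1 (h1.and h2)
    have := h (y := δ / 2) (by
      rw [Real.dist_eq, sub_zero, abs_of_pos (half_pos hδ)]; exact half_lt_self hδ)
    exact ⟨δ / 2, half_pos hδ, this.1.le, this.2.le⟩
  refine ⟨h, hh, fun φ hφ k => ?_⟩
  by_cases hk : ∃ y ∈ cube h k, ‖y‖ ≤ ρ / 2
  · obtain ⟨y, hy, hyρ⟩ := hk
    refine ⟨0, setLIntegral_mono' (measurableSet_cube h k) fun x hx => ?_⟩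
    have hxρ : x ∈ Metric.closedBall (0 : EuclideanSpace ℝ (Fin N)) ρ := by
      rw [mem_closedBall_zero_iff]
      have h1 := norm_sub_le_of_mem_cube hh hy hx
      have h2 := norm_le_norm_add_norm_sub' x y
      linarith
    rw [Set.indicator_of_mem hxρ, sub_zero]
    exact le_add_self
  · push Not at hk
    obtain ⟨a, ha⟩ := hC h hh k φ hφ
    refine ⟨a, ha.trans ?_⟩
    rw [← lintegral_const_mul' _ _ ENNReal.ofReal_ne_top]
    refine setLIntegral_mono' (measurableSet_cube h k) fun x hx => le_add_right ?_
    calc ENNReal.ofReal (C * h ^ 2) * ‖fderiv ℝ φ x‖ₑ ^ 2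
        ≤ ENNReal.ofReal (ε * weight α x) * ‖fderiv ℝ φ x‖ₑ ^ 2 := by
          gcongr ENNReal.ofReal ?_ * _
          refine hhε.trans ?_
          unfold weight
          gcongr
          exact (hk x hx).le
      _ = _ := by
          rw [ENNReal.ofReal_mul hε.le]
          ring

/-- The image of the test functions is approximated by step functions on a grid of cubes. -/
theorem exists_finiteDimensional_approximation (hN : 2 ≤ N) {α : ℝ} (hα0 : 0 < α) (hα2 : α < 2)
    {Ω : Opens (EuclideanSpace ℝ (Fin N))}
    (hΩb : Bornology.IsBounded (Ω : Set (EuclideanSpace ℝ (Fin N)))) {ε : ℝ} (hε : 0 < ε) :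
    ∃ V : Submodule ℝ (Lp ℝ 2 (volume.restrict (Ω : Set (EuclideanSpace ℝ (Fin N))))),
      FiniteDimensional ℝ V ∧
        ∀ p ∈ testSubmodule Ω α, ∃ v ∈ V, ‖toL2 Ω α p - v‖ ≤ ε * ‖p‖ := by
  -- Half of the squared error is spent on the Poincaré cubes, half on the ball around the origin.
  have hε2 : 0 < ε ^ 2 / 2 := by positivity
  obtain ⟨ρ, hρ, hρε⟩ := exists_hardyConst_le hα2 hε2
  obtain ⟨h, hh, happrox⟩ := exists_cube_approximation (N := N) hα0 hρ hε2
  obtain ⟨K, hK⟩ := exists_finset_cube_cover hh hΩb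
  have hfin : ∀ k : Fin N → ℤ, volume.restrict (Ω : Set (EuclideanSpace ℝ (Fin N))) (cube h k) ≠ ∞ :=
    fun k => ((measure_mono (Set.subset_univ _)).trans_lt (by
      rw [Measure.restrict_apply_univ]; exact hΩb.measure_lt_top)).ne
  let e : (Fin N → ℤ) → Lp ℝ 2 (volume.restrict (Ω : Set (EuclideanSpace ℝ (Fin N)))) :=
    fun k => indicatorConstLp 2 (measurableSet_cube h k) (hfin k) 1
  refine ⟨Submodule.span ℝ (e '' K), FiniteDimensional.span_of_finite ℝ (K.finite_toSet.image e), ?_⟩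
  rintro p ⟨φ, hp⟩
  have hφ : ContDiff ℝ 1 φ := φ.contDiff.of_le (by exact_mod_cast le_top)
  choose a ha using happrox φ hφ
  refine ⟨∑ k ∈ K, a k • e k, Submodule.sum_mem _ fun k hk =>
    Submodule.smul_mem _ _ (Submodule.subset_span ⟨k, hk, rfl⟩), ?_⟩
  refine norm_le_of_enorm_sq_le hε.le ?_
  set w := toL2 Ω α p - ∑ k ∈ K, a k • e k with hw
  have hae : ∀ᵐ x ∂(volume.restrict (Ω : Set (EuclideanSpace ℝ (Fin N)))),
      w x = φ x - ∑ k ∈ K, a k * (cube h k).indicator (fun _ => (1 : ℝ)) x := by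
    have h1 : ∀ᵐ x ∂(volume.restrict (Ω : Set (EuclideanSpace ℝ (Fin N)))),
        ∀ k, (a k • e k : Lp ℝ 2 _) x = a k * (cube h k).indicator (fun _ => (1 : ℝ)) x := by
      refine ae_all_iff.2 fun k => ?_
      filter_upwards [Lp.coeFn_smul (a k) (e k), indicatorConstLp_coeFn (p := 2)
        (hs := measurableSet_cube h k) (hμs := hfin k) (c := (1 : ℝ))] with x hx1 hx2
      rw [hx1, Pi.smul_apply, smul_eq_mul, ← hx2]
    filter_upwards [h1, Lp.coeFn_sub (toL2 Ω α p) (∑ k ∈ K, a k • e k),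
      Lp.coeFn_finsetSum K (fun k => a k • e k), p.2.1.coeFn_toLp,
      (volume_absolutelyContinuous Ω α).ae_eq hp] with x hx1 hx2 hx3 hx4 hx5
    rw [hw, hx2, Pi.sub_apply, hx3, Finset.sum_apply, ← hx5, ← hx4,
      Finset.sum_congr rfl fun k _ => hx1 k]
    rfl
  have hcube : ∀ k ∈ K, ∀ x ∈ cube h k,
      ∑ l ∈ K, a l * (cube h l).indicator (fun _ => (1 : ℝ)) x = a k := fun k hk x hx => by
    rw [Finset.sum_eq_single_of_mem k hk, Set.indicator_of_mem hx, mul_one]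
    intro l _ hlk
    rw [Set.indicator_of_notMem, mul_zero]
    intro hxl
    rw [mem_cube_iff hh] at hx hxl
    exact hlk (hxl.symm.trans hx)
  have hdisj := pairwiseDisjoint_cube (N := N) hh K
  calc ‖w‖ₑ ^ 2
      = ∫⁻ x in Ω, ‖φ x - ∑ k ∈ K, a k * (cube h k).indicator (fun _ => (1 : ℝ)) x‖ₑ ^ 2 := by
        rw [enorm_sq_eq_lintegral]
        refine lintegral_congr_ae ?_
        filter_upwards [hae] with x hx
        rw [hx]
    -- Cubes may cross the boundary of `Ω`: `φ` is smooth on the whole space, so the estimates hold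
    -- on full cubes.
    _ ≤ ∫⁻ x in ⋃ k ∈ K, cube h k,
          ‖φ x - ∑ k ∈ K, a k * (cube h k).indicator (fun _ => (1 : ℝ)) x‖ₑ ^ 2 :=
        lintegral_mono_set hK
    _ = ∑ k ∈ K, ∫⁻ x in cube h k, ‖φ x - a k‖ₑ ^ 2 := by
        rw [lintegral_biUnion_finset hdisj fun k _ => measurableSet_cube h k]
        refine Finset.sum_congr rfl fun k hk => setLIntegral_congr_fun (measurableSet_cube h k)
          fun x hx => ?_
        simp only [hcube k hk x hx]
    _ ≤ ∑ k ∈ K, ∫⁻ x in cube h k,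
          (ENNReal.ofReal (ε ^ 2 / 2) * (‖fderiv ℝ φ x‖ₑ ^ 2 * ENNReal.ofReal (weight α x)) +
            (Metric.closedBall 0 ρ).indicator (fun x => ‖φ x‖ₑ ^ 2) x) :=
        Finset.sum_le_sum fun k _ => ha k
    _ = ∫⁻ x in ⋃ k ∈ K, cube h k,
          (ENNReal.ofReal (ε ^ 2 / 2) * (‖fderiv ℝ φ x‖ₑ ^ 2 * ENNReal.ofReal (weight α x)) +
            (Metric.closedBall 0 ρ).indicator (fun x => ‖φ x‖ₑ ^ 2) x) :=
        (lintegral_biUnion_finset hdisj (fun k _ => measurableSet_cube h k) _).symm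
    _ ≤ ∫⁻ x, (ENNReal.ofReal (ε ^ 2 / 2) *
            (‖fderiv ℝ φ x‖ₑ ^ 2 * ENNReal.ofReal (weight α x)) +
          (Metric.closedBall 0 ρ).indicator (fun x => ‖φ x‖ₑ ^ 2) x) :=
        setLIntegral_le_lintegral _ _
    _ = ENNReal.ofReal (ε ^ 2 / 2) * energy α φ +
          ∫⁻ x in Metric.closedBall 0 ρ, ‖φ x‖ₑ ^ 2 := by
        rw [lintegral_add_right, lintegral_const_mul' _ _ ENNReal.ofReal_ne_top,
          lintegral_indicator Metric.isClosed_closedBall.measurableSet, energy]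
        exact (hφ.continuous.enorm.measurable.pow_const 2).indicator
          Metric.isClosed_closedBall.measurableSet
    _ ≤ ENNReal.ofReal (ε ^ 2 / 2) * energy α φ + ENNReal.ofReal (ε ^ 2 / 2) * energy α φ := by
        gcongr
        refine (setLIntegral_closedBall_enorm_sq_le hN hα0 hα2 hφ φ.hasCompactSupport hρ).trans ?_
        gcongr
    _ = ENNReal.ofReal (ε ^ 2) * energy α φ := by
        rw [← add_mul, ← ENNReal.ofReal_add hε2.le hε2.le, add_halves]
    _ ≤ _ := by gcongr; exact energy_le_enorm_sq hp

theorem embedding_injective (Ω : Opens (EuclideanSpace ℝ (Fin N))) (α : ℝ) :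
    Function.Injective (embedding Ω α) := by
  intro p q hpq
  exact Subtype.ext (H1.ext_fst ((MemLp.toLp_eq_toLp_iff p.1.2.1 q.1.2.1).1 hpq))

theorem exists_norm_embedding_le (hN : 2 ≤ N) {α : ℝ} (hα0 : 0 < α) (hα2 : α < 2)
    {Ω : Opens (EuclideanSpace ℝ (Fin N))}
    (hΩb : Bornology.IsBounded (Ω : Set (EuclideanSpace ℝ (Fin N)))) :
    ∃ C : ℝ, ∀ p : H10 Ω α, ‖embedding Ω α p‖ ≤ C * ‖p‖ := by
  obtain ⟨C, hC0, hC⟩ := exists_norm_toL2_le_of_mem_testSubmodule hN hα0 hα2 hΩb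
  exact ⟨C, fun p => norm_toL2_le_of_mem_closure hC0 hC p.2⟩

/-- `H10` is the closure of the test functions, which are therefore dense in its subspace topology.
-/
theorem dense_testSubmodule (Ω : Opens (EuclideanSpace ℝ (Fin N))) (α : ℝ) :
    Dense {p : H10 Ω α | (p : H1 Ω α) ∈ testSubmodule Ω α} := fun p => by
  have himage : Subtype.val '' {p : H10 Ω α | (p : H1 Ω α) ∈ testSubmodule Ω α} =
      (testSubmodule Ω α : Set (H1 Ω α)) := by
    ext q
    exact ⟨fun ⟨r, hr, hrq⟩ => hrq ▸ hr,
      fun hq => ⟨⟨q, Submodule.le_topologicalClosure _ hq⟩, hq, rfl⟩⟩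
  rw [closure_subtype, himage]
  exact p.2

theorem isCompactOperator_embedding (hN : 2 ≤ N) {α : ℝ} (hα0 : 0 < α) (hα2 : α < 2)
    {Ω : Opens (EuclideanSpace ℝ (Fin N))}
    (hΩb : Bornology.IsBounded (Ω : Set (EuclideanSpace ℝ (Fin N)))) :
    IsCompactOperator (embedding Ω α) := by
  obtain ⟨C, hC⟩ := exists_norm_embedding_le hN hα0 hα2 hΩb
  refine @isCompactOperator_of_forall_exists_finiteDimensional (H10 Ω α)
    (Lp ℝ 2 (volume.restrict (Ω : Set (EuclideanSpace ℝ (Fin N))))) inferInstance inferInstance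
    inferInstance inferInstance inferInstance (embedding Ω α) C hC _ (dense_testSubmodule Ω α) ?_
  intro ε hε
  obtain ⟨V, hV, hVD⟩ := exists_finiteDimensional_approximation hN hα0 hα2 hΩb hε
  exact ⟨V, hV, fun p hp => hVD p.1 hp⟩

end Compactness

end WeightedSobolev

end

theorem lemma08p15 {N : ℕ} [NeZero N] (hN : 2 ≤ N) (α : ℝ) (hα0 : 0 < α) (hα2 : α < 2)
    (Ω : Opens (EuclideanSpace ℝ (Fin N)))
    (hΩc : IsConnected (Ω : Set (EuclideanSpace ℝ (Fin N))))
    (hΩb : Bornology.IsBounded (Ω : Set (EuclideanSpace ℝ (Fin N))))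
    (h0 : (0 : EuclideanSpace ℝ (Fin N)) ∈ Ω) :
    Function.Injective (WeightedSobolev.embedding Ω α) ∧
      Continuous (WeightedSobolev.embedding Ω α) ∧
      IsCompactOperator (WeightedSobolev.embedding Ω α) := by
  have hcompact := WeightedSobolev.isCompactOperator_embedding hN hα0 hα2 hΩb
  exact ⟨WeightedSobolev.embedding_injective Ω α, hcompact.continuous, hcompact⟩
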